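/- A virtual knot diagram is a generic oriented closed curve in the plane (or on the sphere) with finitely many transverse double points, each marked either as a classical crossing (with over/under information) or as a virtual crossing. A virtual knot $K$ is an equivalence class of such diagrams under orientation-preserving homeomorphism and the generalized Reidemeister moves: the three classical moves, their three purely virtual analogues, and the mixed move that carries a strand with two virtual crossings past a classical crossing. Let $D$ be a diagram of $K$. For a classical crossing $c$ let $\varepsilon(c)=\pm1$ be its sign. Give the over-crossing point of $c$ the sign $-\varepsilon(c)$ and the under-crossing point of $c$ the sign $\varepsilon(c)$. The index $\mathrm{Ind}(c)$ is the sum of the signs of all classical over- and under-crossing points met strictly between the over-crossing point and the under-crossing point of $c$, when travelling along the knot from the former to the latter. The writhe polynomial $$W_K(t)=\sum_{c}\varepsilon(c)\left(t^{\mathrm{Ind}(c)}-1\right)\in\mathbb{Z}[t,t^{-1}],$$ where $c$ runs over the classical crossings of $D$, depends only on $K$. (That is, for $n\neq 0$ the coefficient of $t^n$ is the sum of the signs of the crossings of index $n$, and the constant coefficient is the sum of the signs of the crossings of index $0$ minus the writhe of $D$.) The virtual crossing number $vc(K)$ is the minimum, over all diagrams of $K$, of the number of virtual crossings. **Theorem.**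 For every virtual knot $K$, $$\mathrm{width}(W_K(t))\le 2\,vc(K),$$ where $\mathrm{width}(W_K(t))$ is the largest exponent minus the smallest exponent of $t$ occurring in $W_K(t)$ with nonzero coefficient (and $0$ if $W_K=0$). -/

import Mathlib

/-!
# Virtual knots, the writhe polynomial and the virtual crossing number

A virtual knot diagram is an oriented closed curve with finitely many transverse double points,
each marked as a classical crossing (with over/under information) or as a virtual crossing.
Such a diagram, up to orientation preserving homeomorphism, is recorded by the cyclic word of
the crossing points met in one tour of the curve, where each double point is met twice.
-/

namespace VKnot

/-- How a strand passes a crossing: over a classical crossing, under a classical crossing, or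
through a virtual crossing. -/
inductive Kind where
  | over
  | under
  | virt
deriving DecidableEq

/-- How the other strand passes the same crossing. -/
def Kind.opp : Kind → Kind
  | .over => .under
  | .under => .over
  | .virt => .virt

/-- One passage of the curve through a crossing: the name of the crossing, the kind of the
passage, and whether the other strand crosses the present one towards its left
(`left = true`, i.e. (own tangent, other tangent) is a positive basis) or towards its right. -/
structure Visit where
  crossing : ℕ
  kind : Kind
  left : Bool
deriving DecidableEq

/-- The other passage through the same crossing. -/
def Visit.partner (v : Visit) : Visit := ⟨v.crossing, v.kind.opp, !v.left⟩

/-- A word of visits describes a closed curve with double points: every crossing is visited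
exactly twice, the two visits being partners of each other. -/
def IsCode (w : List Visit) : Prop :=
  w.Nodup ∧ (∀ v ∈ w, v.partner ∈ w) ∧
    ∀ v ∈ w, ∀ u ∈ w, u.crossing = v.crossing → u = v ∨ u = v.partner

/-! ### Planarity

Edge number `i` of a word `w` runs from visit `i` to the (cyclically) next visit. It has a left
side `(i, true)` and a right side `(i, false)`. -/

/-- The two sides of edges that bound a common corner at a crossing. Here `i` and `j` are the
edges that arrive at the two visits of the crossing, `finRotate _ i` and `finRotate _ j` are the
edges that leave it, and the second strand crosses the first one from right to left. -/
inductive Corner (w : List Visit) : Fin w.length × Bool → Fin w.length × Bool → Prop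
  | front_left (i j : Fin w.length) (hl : (w.get (finRotate _ i)).left = true)
      (hp : w.get (finRotate _ j) = (w.get (finRotate _ i)).partner) :
      Corner w (finRotate _ i, true) (finRotate _ j, false)
  | front_right (i j : Fin w.length) (hl : (w.get (finRotate _ i)).left = true)
      (hp : w.get (finRotate _ j) = (w.get (finRotate _ i)).partner) :
      Corner w (finRotate _ i, false) (j, false)
  | back_left (i j : Fin w.length) (hl : (w.get (finRotate _ i)).left = true)
      (hp : w.get (finRotate _ j) = (w.get (finRotate _ i)).partner) :
      Corner w (i, true) (finRotate _ j, true)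
  | back_right (i j : Fin w.length) (hl : (w.get (finRotate _ i)).left = true)
      (hp : w.get (finRotate _ j) = (w.get (finRotate _ i)).partner) :
      Corner w (i, false) (j, true)

/-- The regions of the curve: the classes of sides of edges under going around corners. Gluing a
disc along each of them gives the closed oriented surface on which the curve is drawn. -/
def Region (w : List Visit) : Type := Quot (Corner w)

/-- The curve is drawn on the sphere (equivalently in the plane): Euler's formula `V + F = E + 2`
holds, where there are `w.length` edges and half as many crossings. The word without visits is the
embedded circle. -/
def IsPlanar (w : List Visit) : Prop :=
  w = [] ∨ w.length / 2 + Nat.card (Region w) = w.length + 2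

/-- A virtual knot diagram (oriented, with a base point and named crossings). -/
structure Diagram where
  word : List Visit
  isCode : IsCode word
  isPlanar : IsPlanar word

/-! ### The generalized Reidemeister moves

A disc that is cut off by the curve and has one, two or three corners is run around
counterclockwise, so that the disc lies to the left. Its boundary consists of pieces of the
strands `1, 2, …` in this order; the corner at which strand `i` is left for the next strand is
the exit corner of strand `i` and the entry corner of the next strand. The boolean `dᵢ` says
whether strand `i` is oriented along this tour. Then at its exit corner strand `i` sees the next
strand cross to the left if and only if `dᵢ = dᵢ₊₁`. -/

/-- The visit of a strand with direction `d` at its exit corner `c`, where it meets the next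
strand, which has direction `d'`; the strand passes this corner in the manner `k`. -/
def exitVisit (c : ℕ) (k : Kind) (d d' : Bool) : Visit := ⟨c, k, d == d'⟩

/-- The visit of the next strand at the same corner. -/
def entryVisit (c : ℕ) (k : Kind) (d d' : Bool) : Visit := (exitVisit c k d d').partner

/-- The piece of the code given by a strand with direction `d`, entry visit `a`, exit visit `b`. -/
def strand (d : Bool) (a b : Visit) : List Visit := if d then [a, b] else [b, a]

/-- The kinds of three crossings for which a strand may be moved across the crossing of the other
two; `k₁, k₂, k₃` are the kinds in which strands `1, 2, 3` pass their exit corners. Either all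
three crossings are classical and the strands lie at three different heights (third classical
move), or at least two of the crossings are virtual (third virtual move and mixed move). -/
def TriangleKinds (k₁ k₂ k₃ : Kind) : Prop :=
  (k₁ ≠ .virt ∧ k₂ ≠ .virt ∧ k₃ ≠ .virt ∧ ¬(k₁ = k₂ ∧ k₂ = k₃)) ∨
    (k₁ = .virt ∧ k₂ = .virt) ∨ (k₂ = .virt ∧ k₃ = .virt) ∨ (k₃ = .virt ∧ k₁ = .virt)

/-- Generalized Reidemeister moves, as well as change of base point and of names. In each
constructor the base point is conveniently placed. -/
inductive Move : List Visit → List Visit → Prop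
  /-- Change of the base point. -/
  | rotate (w₁ w₂ : List Visit) : Move (w₁ ++ w₂) (w₂ ++ w₁)
  /-- Renaming of the crossings. -/
  | rename (f : Equiv.Perm ℕ) (w : List Visit) :
      Move w (w.map fun v => { v with crossing := f v.crossing })
  /-- First move, classical (`k = over`, `k = under`) or virtual (`k = virt`): a disc with one
  corner is created. -/
  | one (c : ℕ) (k : Kind) (d : Bool) (w : List Visit) :
      Move w (strand d (entryVisit c k d d) (exitVisit c k d d) ++ w)
  /-- Second move, classical or virtual: a disc with two corners is created, on which strand `1`
  passes both corners in the manner `k`. -/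
  | two (c₁ c₂ : ℕ) (k : Kind) (d₁ d₂ : Bool) (w₁ w₂ : List Visit) :
      Move (w₁ ++ w₂)
        (strand d₁ (entryVisit c₂ k.opp d₂ d₁) (exitVisit c₁ k d₁ d₂) ++ w₁ ++
          strand d₂ (entryVisit c₁ k d₁ d₂) (exitVisit c₂ k.opp d₂ d₁) ++ w₂)
  /-- Third move, classical, virtual or mixed: a disc with three corners is turned over. The knot
  runs through the strands in the order `1, 2, 3`. -/
  | three (c₁ c₂ c₃ : ℕ) (k₁ k₂ k₃ : Kind) (d₁ d₂ d₃ : Bool) (w₁ w₂ w₃ : List Visit)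
      (hk : TriangleKinds k₁ k₂ k₃) :
      Move
        (strand d₁ (entryVisit c₃ k₃ d₃ d₁) (exitVisit c₁ k₁ d₁ d₂) ++ w₁ ++
          strand d₂ (entryVisit c₁ k₁ d₁ d₂) (exitVisit c₂ k₂ d₂ d₃) ++ w₂ ++
          strand d₃ (entryVisit c₂ k₂ d₂ d₃) (exitVisit c₃ k₃ d₃ d₁) ++ w₃)
        (strand (!d₁) (entryVisit c₃ k₃ d₃ d₁) (exitVisit c₁ k₁ d₁ d₂) ++ w₁ ++
          strand (!d₂) (entryVisit c₁ k₁ d₁ d₂) (exitVisit c₂ k₂ d₂ d₃) ++ w₂ ++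
          strand (!d₃) (entryVisit c₂ k₂ d₂ d₃) (exitVisit c₃ k₃ d₃ d₁) ++ w₃)
  /-- Third move, where the knot runs through the strands in the order `1, 3, 2`. -/
  | threeSwapped (c₁ c₂ c₃ : ℕ) (k₁ k₂ k₃ : Kind) (d₁ d₂ d₃ : Bool) (w₁ w₂ w₃ : List Visit)
      (hk : TriangleKinds k₁ k₂ k₃) :
      Move
        (strand d₁ (entryVisit c₃ k₃ d₃ d₁) (exitVisit c₁ k₁ d₁ d₂) ++ w₁ ++
          strand d₃ (entryVisit c₂ k₂ d₂ d₃) (exitVisit c₃ k₃ d₃ d₁) ++ w₂ ++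
          strand d₂ (entryVisit c₁ k₁ d₁ d₂) (exitVisit c₂ k₂ d₂ d₃) ++ w₃)
        (strand (!d₁) (entryVisit c₃ k₃ d₃ d₁) (exitVisit c₁ k₁ d₁ d₂) ++ w₁ ++
          strand (!d₃) (entryVisit c₂ k₂ d₂ d₃) (exitVisit c₃ k₃ d₃ d₁) ++ w₂ ++
          strand (!d₂) (entryVisit c₁ k₁ d₁ d₂) (exitVisit c₂ k₂ d₂ d₃) ++ w₃)

/-- A virtual knot: a class of virtual knot diagrams under the equivalence relation generated by
the generalized Reidemeister moves. -/
def VirtualKnot : Type := Quot fun D D' : Diagram => Move D.word D'.word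

/-! ### The writhe polynomial -/

open LaurentPolynomial

/-- The sign of the crossing of a visit: a crossing is positive if (tangent of the over strand,
tangent of the under strand) is a positive basis. For virtual crossings the value is `0`. -/
def Visit.sign (v : Visit) : ℤ :=
  match v.kind, v.left with
  | .over, true => 1
  | .over, false => -1
  | .under, true => -1
  | .under, false => 1
  | .virt, _ => 0

/-- The sign of a visit as an endpoint of a chord of the Gauss diagram: minus the sign of the
crossing at the over crossing, the sign of the crossing at the under crossing. Virtual crossings do
not occur in the Gauss diagram, and contribute nothing. -/
def Visit.endSign (v : Visit) : ℤ :=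
  match v.kind with
  | .over => -v.sign
  | .under => v.sign
  | .virt => 0

/-- The visits strictly between `v` and its partner, in the direction of the knot, from `v`. -/
def arc (w : List Visit) (v : Visit) : List Visit :=
  (w.rotate (w.idxOf v)).tail.takeWhile (fun u => decide (u ≠ v.partner))

/-- The index of the classical crossing with over crossing point `v`: the sum of the signs of the
endpoints on the arc from the over crossing point to the under crossing point. -/
def index (w : List Visit) (v : Visit) : ℤ := ((arc w v).map Visit.endSign).sum

/-- The over crossing points, one for each classical crossing. -/
def overs (w : List Visit) : List Visit := w.filter (fun v => decide (v.kind = .over))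

/-- The writhe: the sum of the signs of the classical crossings. -/
def writhe (w : List Visit) : ℤ := ((overs w).map Visit.sign).sum

/-- The writhe polynomial of a diagram: the coefficient of `T n` is the sum of the signs of the
classical crossings of index `n`, which for `n = 0` is diminished by the writhe. -/
noncomputable def writhePolyOfWord (w : List Visit) : ℤ[T;T⁻¹] :=
  ((overs w).map fun v => C v.sign * T (index w v)).sum - C (writhe w)

/-! ### Invariance of the writhe polynomial

The index of a crossing is computed from the partial sums of the endpoint signs along the word. -/

/-- The sum of the endpoint signs before `u` in the word. -/
def partialSum : List Visit → Visit → ℤ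
  | [], _ => 0
  | x :: t, u => if u = x then 0 else x.endSign + partialSum t u

/-- The contribution of a visit to the writhe polynomial, for given partial sums. -/
noncomputable def contribution (φ : Visit → ℤ) (v : Visit) : ℤ[T;T⁻¹] :=
  if v.kind = .over then C v.sign * (T (φ v.partner - φ v - v.endSign) - 1) else 0

theorem Kind.opp_opp (k : Kind) : k.opp.opp = k := by cases k <;> rfl

theorem Visit.partner_partner (v : Visit) : v.partner.partner = v := by
  cases v; simp [Visit.partner, Kind.opp_opp]

theorem Visit.partner_ne (v : Visit) : v.partner ≠ v := by
  cases v; simp [Visit.partner]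

theorem Visit.endSign_partner (v : Visit) : v.partner.endSign = -v.endSign := by
  rcases v with ⟨c, k, l⟩
  cases k <;> cases l <;> rfl

theorem partialSum_append_of_mem {A : List Visit} (B : List Visit) {u : Visit} (h : u ∈ A) :
    partialSum (A ++ B) u = partialSum A u := by
  induction A with
  | nil => simp at h
  | cons x t ih =>
    by_cases hx : u = x
    · simp [partialSum, hx]
    · have : u ∈ t := by simpa [hx] using h
      simp [partialSum, hx, ih this]

theorem partialSum_append_of_notMem {A : List Visit} (B : List Visit) {u : Visit} (h : u ∉ A) :
    partialSum (A ++ B) u = (A.map Visit.endSign).sum + partialSum B u := by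
  induction A with
  | nil => simp
  | cons x t ih =>
    have h' : u ≠ x ∧ u ∉ t := by simpa using h
    simp [partialSum, h'.1, ih h'.2, add_assoc]

theorem takeWhile_ne_append (A B : List Visit) (u : Visit) (h : u ∉ A) :
    (A ++ u :: B).takeWhile (fun x => decide (x ≠ u)) = A := by
  induction A with
  | nil => simp
  | cons x t ih =>
    have h' : u ≠ x ∧ u ∉ t := by simpa using h
    have hx : x ≠ u := fun e => h'.1 e.symm
    simpa [hx] using ih h'.2

theorem sum_endSign_eq_zero {w : List Visit} (hw : IsCode w) :
    (w.map Visit.endSign).sum = 0 := by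
  have hp : (w.map Visit.partner).Perm w := by
    have hnd : (w.map Visit.partner).Nodup :=
      hw.1.map (fun a b h => by rw [← a.partner_partner, h, b.partner_partner])
    refine (List.perm_ext_iff_of_nodup hnd hw.1).2 fun a => ?_
    constructor
    · intro h
      obtain ⟨b, hb, rfl⟩ := List.mem_map.1 h
      exact hw.2.1 b hb
    · intro h
      exact List.mem_map.2 ⟨a.partner, hw.2.1 a h, a.partner_partner⟩
  have h1 := (hp.map Visit.endSign).sum_eq
  have h2 : ((w.map Visit.partner).map Visit.endSign).sum = -(w.map Visit.endSign).sum := by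
    rw [List.map_map]
    clear hw hp h1
    induction w with
    | nil => simp
    | cons x t ih =>
      simp only [List.map_cons, List.sum_cons, ih, Function.comp, Visit.endSign_partner]
      ring
  omega

theorem index_eq {w : List Visit} (hw : IsCode w) {v : Visit} (hv : v ∈ w) :
    index w v = partialSum w v.partner - partialSum w v - v.endSign := by
  obtain ⟨P, S, rfl⟩ := List.append_of_mem hv
  have hz := sum_endSign_eq_zero hw
  have hnd := hw.1
  have hvP : v ∉ P := by
    intro h
    have := List.nodup_append.1 hnd
    exact this.2.2 v h v (by simp) rfl
  have hvS : v ∉ S := by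
    have := (List.nodup_append.1 hnd).2.1
    exact (List.nodup_cons.1 this).1
  have hidx : (P ++ v :: S).idxOf v = P.length := by
    rw [List.idxOf_append_of_notMem hvP]; simp
  have hrot : (P ++ v :: S).rotate ((P ++ v :: S).idxOf v) = v :: (S ++ P) := by
    rw [hidx, List.rotate_append_length_eq]; simp
  have hne : v.partner ≠ v := v.partner_ne
  have hmem : v.partner ∈ P ∨ v.partner ∈ S := by
    have := hw.2.1 v hv
    simpa [hne] using this
  unfold index arc
  rw [hrot, List.tail_cons]
  rw [partialSum_append_of_notMem _ hvP]
  simp only [List.map_append, List.map_cons, List.sum_append, List.sum_cons] at hz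
  rcases hmem with h | h
  · have hS : v.partner ∉ S := by
      intro h'
      have := List.nodup_append.1 hnd
      exact this.2.2 _ h _ (by simp [h']) rfl
    rw [partialSum_append_of_mem _ h]
    obtain ⟨A, B, rfl⟩ := List.append_of_mem h
    have hA : v.partner ∉ A := by
      have := (List.nodup_append.1 (List.nodup_append.1 hnd).1)
      intro h'
      exact this.2.2 _ h' _ (by simp) rfl
    rw [partialSum_append_of_notMem _ hA, ← List.append_assoc,
      takeWhile_ne_append _ _ _ (by simp [hS, hA])]
    simp only [List.map_append, List.map_cons, List.sum_append, List.sum_cons, partialSum,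
      if_true] at hz ⊢
    linarith
  · have hP : v.partner ∉ P := by
      intro h'
      have := List.nodup_append.1 hnd
      exact this.2.2 _ h' _ (by simp [h]) rfl
    rw [partialSum_append_of_notMem _ hP]
    obtain ⟨A, B, rfl⟩ := List.append_of_mem h
    have hA : v.partner ∉ A := by
      have := (List.nodup_append.1 (List.nodup_cons.1 (List.nodup_append.1 hnd).2.1).2)
      intro h'
      exact this.2.2 _ h' _ (by simp) rfl
    rw [List.append_assoc, List.cons_append, takeWhile_ne_append _ _ _ hA]
    simp only [partialSum, if_neg hne, if_true, partialSum_append_of_notMem _ hA]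
    ring

theorem writhePolyOfWord_eq {w : List Visit} (hw : IsCode w) :
    writhePolyOfWord w = (w.map (contribution (partialSum w))).sum := by
  have h1 : w.map (contribution (partialSum w)) =
      w.map (fun v => if v.kind = .over then C v.sign * (T (index w v) - 1) else 0) := by
    refine List.map_congr_left fun v hv => ?_
    rw [contribution, index_eq hw hv]
  rw [h1]
  unfold writhePolyOfWord writhe overs
  generalize index w = f
  clear h1 hw
  induction w with
  | nil => simp
  | cons x t ih =>
    simp only [List.map_cons, List.sum_cons, ← ih]
    by_cases hx : x.kind = .over
    · simp [hx]
      ring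
    · simp [hx]

/-- Words whose visits agree up to order, and give each crossing the same index. -/
theorem writhePolyOfWord_congr_perm {w w' : List Visit} (hw : IsCode w) (hw' : IsCode w')
    (hp : w.Perm w') (h : ∀ v ∈ w, v.kind = .over →
      partialSum w v.partner - partialSum w v = partialSum w' v.partner - partialSum w' v) :
    writhePolyOfWord w = writhePolyOfWord w' := by
  rw [writhePolyOfWord_eq hw, writhePolyOfWord_eq hw', ← (hp.map _).sum_eq]
  congr 1
  refine List.map_congr_left fun v hv => ?_
  unfold contribution
  split_ifs with hk
  · rw [h v hv hk]
  · rfl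

theorem writhePoly_rotate {w₁ w₂ : List Visit} (h : IsCode (w₁ ++ w₂)) (h' : IsCode (w₂ ++ w₁)) :
    writhePolyOfWord (w₁ ++ w₂) = writhePolyOfWord (w₂ ++ w₁) := by
  refine writhePolyOfWord_congr_perm h h' List.perm_append_comm fun v hv _ => ?_
  have hz := sum_endSign_eq_zero h
  have key : ∀ u ∈ w₁ ++ w₂, partialSum (w₂ ++ w₁) u =
      partialSum (w₁ ++ w₂) u + (w₂.map Visit.endSign).sum := by
    intro u hu
    have hd := (List.nodup_append.1 h.1).2.2
    rw [List.map_append, List.sum_append] at hz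
    rcases List.mem_append.1 hu with h1 | h2
    · have h2 : u ∉ w₂ := fun h2 => hd u h1 u h2 rfl
      rw [partialSum_append_of_notMem _ h2, partialSum_append_of_mem _ h1]
      ring
    · have h1 : u ∉ w₁ := fun h1 => hd u h1 u h2 rfl
      rw [partialSum_append_of_notMem _ h1, partialSum_append_of_mem _ h2]
      linarith
  rw [key v hv, key _ (h.2.1 v hv)]
  ring

theorem writhePoly_rename (f : Equiv.Perm ℕ) {w : List Visit} (h : IsCode w)
    (h' : IsCode (w.map fun v => { v with crossing := f v.crossing })) :
    writhePolyOfWord w =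
      writhePolyOfWord (w.map fun v => { v with crossing := f v.crossing }) := by
  rw [writhePolyOfWord_eq h, writhePolyOfWord_eq h', List.map_map]
  set g : Visit → Visit := fun v => { v with crossing := f v.crossing } with hg
  have hinj : Function.Injective g := by
    rintro ⟨a, b, c⟩ ⟨a', b', c'⟩ e
    simpa [hg] using e
  have hps : ∀ (t : List Visit) (u : Visit), partialSum (t.map g) (g u) = partialSum t u := by
    intro t u
    induction t with
    | nil => rfl
    | cons x t ih =>
      simp only [List.map_cons, partialSum, hinj.eq_iff, ih]
      rfl
  congr 1
  refine List.map_congr_left fun v _ => ?_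
  have hgp : (g v).partner = g v.partner := rfl
  simp only [Function.comp, contribution, hgp, hps]
  rfl

theorem partialSum_cons_cons_cancel {x y u : Visit} (t : List Visit)
    (h : x.endSign + y.endSign = 0) (hx : u ≠ x) (hy : u ≠ y) :
    partialSum (x :: y :: t) u = partialSum t u := by
  simp only [partialSum, hx, hy, if_false]
  linarith

theorem term_congr {φ ψ : Visit → ℤ} {v : Visit} (h : φ v = ψ v)
    (h' : φ v.partner = ψ v.partner) : contribution φ v = contribution ψ v := by
  unfold contribution
  rw [h, h']

theorem partner_ne_of_ne {a b : Visit} (h : a ≠ b.partner) : a.partner ≠ b := by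
  intro e
  exact h (by rw [← e, a.partner_partner])

theorem writhePoly_one {x : Visit} {w : List Visit} (h : IsCode w)
    (h' : IsCode ([x, x.partner] ++ w)) :
    writhePolyOfWord w = writhePolyOfWord ([x, x.partner] ++ w) := by
  rw [writhePolyOfWord_eq h, writhePolyOfWord_eq h']
  have hne := x.partner_ne
  have hnd := h'.1
  simp only [List.cons_append, List.nil_append, List.nodup_cons, List.mem_cons, not_or] at hnd
  have hs : x.endSign + x.partner.endSign = 0 := by rw [x.endSign_partner]; ring
  have e : w.map (contribution (partialSum w)) =
      w.map (contribution (partialSum ([x, x.partner] ++ w))) := by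
    refine List.map_congr_left fun v hv => ?_
    have h1 : v ≠ x := fun e => hnd.1.2 (e ▸ hv)
    have h2 : v ≠ x.partner := fun e => hnd.2.1 (e ▸ hv)
    refine term_congr (partialSum_cons_cons_cancel w hs h1 h2).symm
      (partialSum_cons_cons_cancel w hs (partner_ne_of_ne h2) (partner_ne_of_ne ?_)).symm
    rwa [x.partner_partner]
  have z1 : contribution (partialSum ([x, x.partner] ++ w)) x = 0 := by
    simp [contribution, partialSum, hne]
  have z2 : contribution (partialSum ([x, x.partner] ++ w)) x.partner = 0 := by
    simp [contribution, partialSum, hne, x.partner_partner, x.endSign_partner]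
  rw [List.map_append, ← e, List.sum_append, List.map_cons, List.map_cons, List.map_nil,
    List.sum_cons, List.sum_cons, List.sum_nil, z1, z2]
  simp

theorem term_four_eq_zero {φ : Visit → ℤ} {x y : Visit} (hk : x.kind = y.kind)
    (hl : x.left = !y.left)
    (h : φ x.partner - φ x - x.endSign = φ y.partner - φ y - y.endSign) :
    contribution φ x + contribution φ y + (contribution φ x.partner + contribution φ y.partner) = 0 := by
  have hx : φ x.partner.partner - φ x.partner - x.partner.endSign =
      -(φ x.partner - φ x - x.endSign) := by
    rw [x.partner_partner, x.endSign_partner]; ring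
  have hy : φ y.partner.partner - φ y.partner - y.partner.endSign =
      -(φ y.partner - φ y - y.endSign) := by
    rw [y.partner_partner, y.endSign_partner]; ring
  unfold contribution
  rw [hx, hy, h]
  rcases x with ⟨a, k, l⟩
  rcases y with ⟨b, k', l'⟩
  obtain rfl : k = k' := hk
  obtain rfl : l = !l' := hl
  cases k <;> cases l' <;> simp [Visit.partner, Kind.opp, Visit.sign]

theorem writhePoly_two {x y p q : Visit} {w₁ w₂ : List Visit} (hk : x.kind = y.kind)
    (hl : x.left = !y.left)
    (hpq : (p = x.partner ∧ q = y.partner) ∨ (p = y.partner ∧ q = x.partner))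
    (h : IsCode (w₁ ++ w₂)) (h' : IsCode ([x, y] ++ w₁ ++ [p, q] ++ w₂)) :
    writhePolyOfWord (w₁ ++ w₂) = writhePolyOfWord ([x, y] ++ w₁ ++ [p, q] ++ w₂) := by
  rw [writhePolyOfWord_eq h, writhePolyOfWord_eq h']
  have hxy : x.endSign + y.endSign = 0 := by
    rcases x with ⟨a, k, l⟩
    rcases y with ⟨b, k', l'⟩
    obtain rfl : k = k' := hk
    obtain rfl : l = !l' := hl
    cases k <;> cases l' <;> rfl
  have hpq0 : p.endSign + q.endSign = 0 := by
    rcases hpq with ⟨rfl, rfl⟩ | ⟨rfl, rfl⟩ <;> simp only [Visit.endSign_partner] <;> linarith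
  have hnd := h'.1
  simp only [List.append_assoc, List.cons_append, List.nil_append, List.nodup_cons,
    List.nodup_append, List.mem_append, List.mem_cons, not_or] at hnd
  obtain ⟨⟨hxy', hxw₁, hxp, hxq, hxw₂⟩, ⟨hyw₁, hyp, hyq, hyw₂⟩, -, ⟨⟨hpq', hpw₂⟩, hqw₂, -⟩, hd⟩ :=
    hnd
  have hpw₁ : p ∉ w₁ := fun e => hd p e p (Or.inl rfl) rfl
  have hqw₁ : q ∉ w₁ := fun e => hd q e q (Or.inr (Or.inl rfl)) rfl
  set w := [x, y] ++ w₁ ++ [p, q] ++ w₂ with hw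
  have key : ∀ u, u ≠ x → u ≠ y → u ≠ p → u ≠ q →
      partialSum (w₁ ++ w₂) u = partialSum w u := by
    intro u h1 h2 h3 h4
    have : w = x :: y :: (w₁ ++ (p :: q :: w₂)) := by simp [hw]
    rw [this, partialSum_cons_cons_cancel _ hxy h1 h2]
    by_cases hu : u ∈ w₁
    · rw [partialSum_append_of_mem _ hu, partialSum_append_of_mem _ hu]
    · rw [partialSum_append_of_notMem _ hu, partialSum_append_of_notMem _ hu,
        partialSum_cons_cons_cancel _ hpq0 h3 h4]
  have e : ∀ v ∈ w₁ ++ w₂, contribution (partialSum (w₁ ++ w₂)) v = contribution (partialSum w) v := by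
    intro v hv
    have hne : ∀ u ∈ w₁ ++ w₂, u ≠ x ∧ u ≠ y ∧ u ≠ p ∧ u ≠ q := by
      intro u hu
      rcases List.mem_append.1 hu with h1 | h1
      · exact ⟨fun e => hxw₁ (e ▸ h1), fun e => hyw₁ (e ▸ h1), fun e => hpw₁ (e ▸ h1),
          fun e => hqw₁ (e ▸ h1)⟩
      · exact ⟨fun e => hxw₂ (e ▸ h1), fun e => hyw₂ (e ▸ h1), fun e => hpw₂ (e ▸ h1),
          fun e => hqw₂ (e ▸ h1)⟩
    obtain ⟨a1, a2, a3, a4⟩ := hne v hv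
    obtain ⟨b1, b2, b3, b4⟩ := hne _ (h.2.1 v hv)
    exact term_congr (key v a1 a2 a3 a4) (key _ b1 b2 b3 b4)
  have e1 : w₁.map (contribution (partialSum (w₁ ++ w₂))) = w₁.map (contribution (partialSum w)) :=
    List.map_congr_left fun v hv => e v (by simp [hv])
  have e2 : w₂.map (contribution (partialSum (w₁ ++ w₂))) = w₂.map (contribution (partialSum w)) :=
    List.map_congr_left fun v hv => e v (by simp [hv])
  have px : partialSum w x = 0 := by simp [hw, partialSum]
  have py : partialSum w y = x.endSign := by simp [hw, partialSum, Ne.symm hxy']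
  have pp : partialSum w p = (w₁.map Visit.endSign).sum := by
    have : w = [x, y] ++ w₁ ++ (p :: q :: w₂) := by simp [hw]
    rw [this, partialSum_append_of_notMem _ (by simp [hpw₁, Ne.symm hxp, Ne.symm hyp])]
    simp only [List.map_append, List.map_cons, List.sum_append, List.sum_cons, List.map_nil,
      List.sum_nil, partialSum, if_true]
    linarith
  have pq : partialSum w q = (w₁.map Visit.endSign).sum + p.endSign := by
    have : w = [x, y] ++ w₁ ++ (p :: q :: w₂) := by simp [hw]
    rw [this, partialSum_append_of_notMem _ (by simp [hqw₁, Ne.symm hxq, Ne.symm hyq])]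
    simp only [List.map_append, List.map_cons, List.sum_append, List.sum_cons, List.map_nil,
      List.sum_nil, partialSum, if_true, Ne.symm hpq', if_false]
    linarith
  have z : contribution (partialSum w) x + contribution (partialSum w) y +
      (contribution (partialSum w) p + contribution (partialSum w) q) = 0 := by
    rcases hpq with ⟨rfl, rfl⟩ | ⟨rfl, rfl⟩
    · refine term_four_eq_zero hk hl ?_
      rw [px, py, pp, pq, x.endSign_partner]
      linarith
    · rw [add_comm (contribution _ y.partner)]
      refine term_four_eq_zero hk hl ?_
      rw [px, py, pp, pq, y.endSign_partner]
      linarith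
  have e3 : (w.map (contribution (partialSum w))).sum =
      (w₁.map (contribution (partialSum w))).sum + (w₂.map (contribution (partialSum w))).sum +
        (contribution (partialSum w) x + contribution (partialSum w) y +
          (contribution (partialSum w) p + contribution (partialSum w) q)) := by
    generalize contribution (partialSum w) = F
    rw [hw]
    simp only [List.map_append, List.map_cons, List.sum_append, List.sum_cons, List.map_nil,
      List.sum_nil]
    ring
  rw [e3, z, List.map_append, List.sum_append, e1, e2, add_zero]

/-- The orientation sign of a strand. -/
def dirSign (d : Bool) : ℤ := if d then 1 else -1

theorem partialSum_strand_of_ne {d : Bool} {a b u : Visit} (t : List Visit) (ha : u ≠ a)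
    (hb : u ≠ b) :
    partialSum (strand d a b ++ t) u = a.endSign + b.endSign + partialSum t u := by
  cases d <;> simp [strand, partialSum, ha, hb] <;> ring

theorem partialSum_strand_entry {d : Bool} {a b : Visit} (t t' : List Visit) (h : a ≠ b) :
    partialSum (strand (!d) a b ++ t') a =
      partialSum (strand d a b ++ t) a + dirSign d * b.endSign := by
  cases d <;> simp [strand, partialSum, h, dirSign]

theorem partialSum_strand_exit {d : Bool} {a b : Visit} (t t' : List Visit) (h : a ≠ b) :
    partialSum (strand (!d) a b ++ t') b =
      partialSum (strand d a b ++ t) b - dirSign d * a.endSign := by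
  cases d <;> simp [strand, partialSum, h.symm, dirSign]

theorem mem_strand {d : Bool} {a b u : Visit} : u ∈ strand d a b ↔ u = a ∨ u = b := by
  cases d <;> simp [strand, or_comm]

theorem strand_perm (d d' : Bool) (a b : Visit) : (strand d a b).Perm (strand d' a b) := by
  cases d <;> cases d' <;> simp [strand, List.Perm.swap]

theorem ne_of_nodup_strand {d : Bool} {a b : Visit} (h : (strand d a b).Nodup) : a ≠ b := by
  cases d <;> simp [strand] at h
  · exact fun e => h e.symm
  · exact h

theorem partialSum_three {d₁ d₂ d₃ : Bool} {a₁ b₁ a₂ b₂ a₃ b₃ : Visit} {A B D : List Visit}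
    {w w' : List Visit}
    (hw : w = strand d₁ a₁ b₁ ++ A ++ strand d₂ a₂ b₂ ++ B ++ strand d₃ a₃ b₃ ++ D)
    (hw' : w' = strand (!d₁) a₁ b₁ ++ A ++ strand (!d₂) a₂ b₂ ++ B ++ strand (!d₃) a₃ b₃ ++ D)
    (hnd : w.Nodup) :
    partialSum w' a₁ = partialSum w a₁ + dirSign d₁ * b₁.endSign ∧
    partialSum w' b₁ = partialSum w b₁ - dirSign d₁ * a₁.endSign ∧
    partialSum w' a₂ = partialSum w a₂ + dirSign d₂ * b₂.endSign ∧
    partialSum w' b₂ = partialSum w b₂ - dirSign d₂ * a₂.endSign ∧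
    partialSum w' a₃ = partialSum w a₃ + dirSign d₃ * b₃.endSign ∧
    partialSum w' b₃ = partialSum w b₃ - dirSign d₃ * a₃.endSign ∧
    ∀ u, u ≠ a₁ → u ≠ b₁ → u ≠ a₂ → u ≠ b₂ → u ≠ a₃ → u ≠ b₃ →
      partialSum w' u = partialSum w u := by
  subst hw hw'
  simp only [List.append_assoc] at hnd ⊢
  have app : ∀ (L t t' : List Visit) (u : Visit) (z : ℤ), u ∉ L →
      partialSum t' u = partialSum t u + z →
      partialSum (L ++ t') u = partialSum (L ++ t) u + z := by
    intro L t t' u z hu e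
    rw [partialSum_append_of_notMem _ hu, partialSum_append_of_notMem _ hu, e]
    ring
  have str : ∀ (d : Bool) (a b : Visit) (t t' : List Visit) (u : Visit) (z : ℤ), u ≠ a → u ≠ b →
      partialSum t' u = partialSum t u + z →
      partialSum (strand (!d) a b ++ t') u = partialSum (strand d a b ++ t) u + z := by
    intro d a b t t' u z ha hb e
    rw [partialSum_strand_of_ne _ ha hb, partialSum_strand_of_ne _ ha hb, e]
    ring
  obtain ⟨n1, hnd, m1⟩ := List.nodup_append.1 hnd
  obtain ⟨-, hnd, m2⟩ := List.nodup_append.1 hnd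
  obtain ⟨n2, hnd, m3⟩ := List.nodup_append.1 hnd
  obtain ⟨-, hnd, m4⟩ := List.nodup_append.1 hnd
  obtain ⟨n3, -, -⟩ := List.nodup_append.1 hnd
  have q1 := ne_of_nodup_strand n1
  have q2 := ne_of_nodup_strand n2
  have q3 := ne_of_nodup_strand n3
  have o1 : ∀ u, u = a₂ ∨ u = b₂ ∨ u = a₃ ∨ u = b₃ → u ≠ a₁ ∧ u ≠ b₁ ∧ u ∉ A := by
    intro u hu
    have hm : u ∈ strand d₂ a₂ b₂ ++ (B ++ (strand d₃ a₃ b₃ ++ D)) := by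
      simp only [List.mem_append, mem_strand]; tauto
    refine ⟨fun e => ?_, fun e => ?_, fun e => m2 u e u hm rfl⟩
    · exact m1 u (mem_strand.2 (Or.inl e)) u (List.mem_append_right _ hm) rfl
    · exact m1 u (mem_strand.2 (Or.inr e)) u (List.mem_append_right _ hm) rfl
  have o2 : ∀ u, u = a₃ ∨ u = b₃ → u ≠ a₂ ∧ u ≠ b₂ ∧ u ∉ B := by
    intro u hu
    have hm : u ∈ strand d₃ a₃ b₃ ++ D := by
      simp only [List.mem_append, mem_strand]; tauto
    refine ⟨fun e => ?_, fun e => ?_, fun e => m4 u e u hm rfl⟩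
    · exact m3 u (mem_strand.2 (Or.inl e)) u (List.mem_append_right _ hm) rfl
    · exact m3 u (mem_strand.2 (Or.inr e)) u (List.mem_append_right _ hm) rfl
  refine ⟨partialSum_strand_entry _ _ q1, partialSum_strand_exit _ _ q1, ?_, ?_, ?_, ?_, ?_⟩
  · obtain ⟨p1, p2, p3⟩ := o1 a₂ (by tauto)
    exact str _ _ _ _ _ _ _ p1 p2 (app _ _ _ _ _ p3 (partialSum_strand_entry _ _ q2))
  · obtain ⟨p1, p2, p3⟩ := o1 b₂ (by tauto)
    exact str _ _ _ _ _ _ _ p1 p2 (app _ _ _ _ _ p3 (partialSum_strand_exit _ _ q2))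
  · obtain ⟨p1, p2, p3⟩ := o1 a₃ (by tauto)
    obtain ⟨p4, p5, p6⟩ := o2 a₃ (by tauto)
    exact str _ _ _ _ _ _ _ p1 p2 (app _ _ _ _ _ p3 (str _ _ _ _ _ _ _ p4 p5
      (app _ _ _ _ _ p6 (partialSum_strand_entry _ _ q3))))
  · obtain ⟨p1, p2, p3⟩ := o1 b₃ (by tauto)
    obtain ⟨p4, p5, p6⟩ := o2 b₃ (by tauto)
    exact str _ _ _ _ _ _ _ p1 p2 (app _ _ _ _ _ p3 (str _ _ _ _ _ _ _ p4 p5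
      (app _ _ _ _ _ p6 (partialSum_strand_exit _ _ q3))))
  · intro u h1 h2 h3 h4 h5 h6
    rw [partialSum_strand_of_ne _ h1 h2, partialSum_strand_of_ne _ h1 h2]
    by_cases hA : u ∈ A
    · rw [partialSum_append_of_mem _ hA, partialSum_append_of_mem _ hA]
    rw [partialSum_append_of_notMem _ hA, partialSum_append_of_notMem _ hA,
      partialSum_strand_of_ne _ h3 h4, partialSum_strand_of_ne _ h3 h4]
    by_cases hB : u ∈ B
    · rw [partialSum_append_of_mem _ hB, partialSum_append_of_mem _ hB]
    rw [partialSum_append_of_notMem _ hB, partialSum_append_of_notMem _ hB,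
      partialSum_strand_of_ne _ h5 h6, partialSum_strand_of_ne _ h5 h6]

theorem endSign_triangle {c₂ c₃ : ℕ} {k₁ k₂ k₃ : Kind} {d₁ d₂ d₃ : Bool}
    (hk : TriangleKinds k₁ k₂ k₃) (h : k₁ ≠ .virt) :
    -(dirSign d₁ * (entryVisit c₃ k₃ d₃ d₁).endSign) =
      dirSign d₂ * (exitVisit c₂ k₂ d₂ d₃).endSign := by
  cases k₁ <;> cases k₂ <;> cases k₃ <;> first
    | exact absurd rfl h
    | (exfalso; revert hk; unfold TriangleKinds; decide)
    | (cases d₁ <;> cases d₂ <;> cases d₃ <;> rfl)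

theorem TriangleKinds.rotate {k₁ k₂ k₃ : Kind} (h : TriangleKinds k₁ k₂ k₃) :
    TriangleKinds k₂ k₃ k₁ := by
  revert h
  cases k₁ <;> cases k₂ <;> cases k₃ <;> unfold TriangleKinds <;> decide

theorem writhePoly_three_aux {w w' : List Visit} {c₁ c₂ c₃ : ℕ} {k₁ k₂ k₃ : Kind}
    {d₁ d₂ d₃ : Bool} (hk : TriangleKinds k₁ k₂ k₃) (h : IsCode w) (h' : IsCode w')
    (hp : w.Perm w') {a₁ b₁ a₂ b₂ a₃ b₃ : Visit}
    (ha₁ : a₁ = entryVisit c₃ k₃ d₃ d₁) (hb₁ : b₁ = exitVisit c₁ k₁ d₁ d₂)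
    (ha₂ : a₂ = entryVisit c₁ k₁ d₁ d₂) (hb₂ : b₂ = exitVisit c₂ k₂ d₂ d₃)
    (ha₃ : a₃ = entryVisit c₂ k₂ d₂ d₃) (hb₃ : b₃ = exitVisit c₃ k₃ d₃ d₁)
    (p₁ : partialSum w' a₁ = partialSum w a₁ + dirSign d₁ * b₁.endSign)
    (q₁ : partialSum w' b₁ = partialSum w b₁ - dirSign d₁ * a₁.endSign)
    (p₂ : partialSum w' a₂ = partialSum w a₂ + dirSign d₂ * b₂.endSign)
    (q₂ : partialSum w' b₂ = partialSum w b₂ - dirSign d₂ * a₂.endSign)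
    (p₃ : partialSum w' a₃ = partialSum w a₃ + dirSign d₃ * b₃.endSign)
    (q₃ : partialSum w' b₃ = partialSum w b₃ - dirSign d₃ * a₃.endSign)
    (r : ∀ u, u ≠ a₁ → u ≠ b₁ → u ≠ a₂ → u ≠ b₂ → u ≠ a₃ → u ≠ b₃ →
      partialSum w' u = partialSum w u) :
    writhePolyOfWord w = writhePolyOfWord w' := by
  have e1 : b₁.partner = a₂ := by rw [ha₂, hb₁]; rfl
  have e2 : b₂.partner = a₃ := by rw [ha₃, hb₂]; rfl
  have e3 : b₃.partner = a₁ := by rw [ha₁, hb₃]; rfl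
  have f1 : a₂.partner = b₁ := by rw [← e1, Visit.partner_partner]
  have f2 : a₃.partner = b₂ := by rw [← e2, Visit.partner_partner]
  have f3 : a₁.partner = b₃ := by rw [← e3, Visit.partner_partner]
  have g1 : k₁ ≠ .virt → -(dirSign d₁ * a₁.endSign) = dirSign d₂ * b₂.endSign := by
    rw [ha₁, hb₂]; exact endSign_triangle hk
  have g2 : k₂ ≠ .virt → -(dirSign d₂ * a₂.endSign) = dirSign d₃ * b₃.endSign := by
    rw [ha₂, hb₃]; exact endSign_triangle hk.rotate
  have g3 : k₃ ≠ .virt → -(dirSign d₃ * a₃.endSign) = dirSign d₁ * b₁.endSign := by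
    rw [ha₃, hb₁]; exact endSign_triangle hk.rotate.rotate
  have kb : ∀ (c : ℕ) (k : Kind) (d d' : Bool), (exitVisit c k d d').kind = .over → k ≠ .virt := by
    rintro c k d d' e rfl
    exact absurd e (by simp [exitVisit])
  have ka : ∀ (c : ℕ) (k : Kind) (d d' : Bool), (entryVisit c k d d').kind = .over → k ≠ .virt := by
    rintro c k d d' e rfl
    exact absurd e (by simp [entryVisit, exitVisit, Visit.partner, Kind.opp])
  refine writhePolyOfWord_congr_perm h h' hp fun v hv ho => ?_
  by_cases c1 : v = a₁
  · subst c1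
    have := g3 (ka _ _ _ _ (ha₁ ▸ ho))
    rw [f3, p₁, q₃]; linarith
  by_cases c2 : v = b₁
  · subst c2
    have := g1 (kb _ _ _ _ (hb₁ ▸ ho))
    rw [e1, p₂, q₁]; linarith
  by_cases c3 : v = a₂
  · subst c3
    have := g1 (ka _ _ _ _ (ha₂ ▸ ho))
    rw [f1, p₂, q₁]; linarith
  by_cases c4 : v = b₂
  · subst c4
    have := g2 (kb _ _ _ _ (hb₂ ▸ ho))
    rw [e2, p₃, q₂]; linarith
  by_cases c5 : v = a₃
  · subst c5
    have := g2 (ka _ _ _ _ (ha₃ ▸ ho))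
    rw [f2, p₃, q₂]; linarith
  by_cases c6 : v = b₃
  · subst c6
    have := g3 (kb _ _ _ _ (hb₃ ▸ ho))
    rw [e3, p₁, q₃]; linarith
  rw [r v c1 c2 c3 c4 c5 c6, r v.partner]
  · exact partner_ne_of_ne (by rwa [f3])
  · exact partner_ne_of_ne (by rwa [e1])
  · exact partner_ne_of_ne (by rwa [f1])
  · exact partner_ne_of_ne (by rwa [e2])
  · exact partner_ne_of_ne (by rwa [f2])
  · exact partner_ne_of_ne (by rwa [e3])

theorem strands_perm (d₁ d₂ d₃ e₁ e₂ e₃ : Bool) (a₁ b₁ a₂ b₂ a₃ b₃ : Visit) (A B D : List Visit) :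
    (strand d₁ a₁ b₁ ++ A ++ strand d₂ a₂ b₂ ++ B ++ strand d₃ a₃ b₃ ++ D).Perm
      (strand e₁ a₁ b₁ ++ A ++ strand e₂ a₂ b₂ ++ B ++ strand e₃ a₃ b₃ ++ D) :=
  ((((((strand_perm _ _ _ _).append_right _).append (strand_perm _ _ _ _)).append_right _).append
    (strand_perm _ _ _ _)).append_right _)

/-- The writhe polynomial is invariant under the generalized Reidemeister moves. -/
theorem writhePolyOfWord_eq_of_move {w w' : List Visit} (m : Move w w') (h : IsCode w)
    (h' : IsCode w') : writhePolyOfWord w = writhePolyOfWord w' := by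
  cases m with
  | rotate w₁ w₂ => exact writhePoly_rotate h h'
  | rename f => exact writhePoly_rename f h h'
  | one c k d =>
    cases d
    · exact writhePoly_one (x := exitVisit c k false false) h h'
    · have e : strand true (entryVisit c k true true) (exitVisit c k true true) =
          [entryVisit c k true true, (entryVisit c k true true).partner] := by
        simp [strand, entryVisit, Visit.partner_partner]
      rw [e] at h' ⊢
      exact writhePoly_one h h'
  | two c₁ c₂ k d₁ d₂ w₁ w₂ =>
    cases d₁ <;> cases d₂ <;> refine writhePoly_two ?_ ?_ ?_ h h' <;>
      simp [entryVisit, exitVisit, Visit.partner, Kind.opp_opp]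
  | three c₁ c₂ c₃ k₁ k₂ k₃ d₁ d₂ d₃ w₁ w₂ w₃ hk =>
    obtain ⟨p₁, q₁, p₂, q₂, p₃, q₃, r⟩ := partialSum_three rfl rfl h.1
    exact writhePoly_three_aux hk h h' (strands_perm _ _ _ _ _ _ _ _ _ _ _ _ _ _ _)
      rfl rfl rfl rfl rfl rfl p₁ q₁ p₂ q₂ p₃ q₃ r
  | threeSwapped c₁ c₂ c₃ k₁ k₂ k₃ d₁ d₂ d₃ w₁ w₂ w₃ hk =>
    obtain ⟨p₁, q₁, p₃, q₃, p₂, q₂, r⟩ := partialSum_three rfl rfl h.1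
    exact writhePoly_three_aux hk h h' (strands_perm _ _ _ _ _ _ _ _ _ _ _ _ _ _ _)
      rfl rfl rfl rfl rfl rfl p₁ q₁ p₂ q₂ p₃ q₃
      (fun u h1 h2 h3 h4 h5 h6 => r u h1 h2 h5 h6 h3 h4)

/-- The writhe polynomial `W_K(t)` of a virtual knot `K`: that of any diagram of `K`. -/
noncomputable def writhePoly : VirtualKnot → ℤ[T;T⁻¹] :=
  Quot.lift (fun D => writhePolyOfWord D.word)
    fun D D' m => writhePolyOfWord_eq_of_move m D.isCode D'.isCode

/-- The width of a Laurent polynomial: its largest exponent minus its smallest exponent, and `0`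
for the zero polynomial. -/
noncomputable def width (p : ℤ[T;T⁻¹]) : ℤ :=
  if h : p.coeff.support.Nonempty then p.coeff.support.max' h - p.coeff.support.min' h else 0

/-! ### The virtual crossing number -/

/-- The number of virtual crossings of a word: each of them has one visit with `left = true`. -/
def virtualCrossings (w : List Visit) : ℕ :=
  w.countP fun v => decide (v.kind = .virt ∧ v.left = true)

/-- The virtual crossing number `vc(K)`: the least number of virtual crossings of a diagram
of `K`. -/
noncomputable def vc (K : VirtualKnot) : ℕ :=
  sInf {n | ∃ D : Diagram, Quot.mk _ D = K ∧ virtualCrossings D.word = n}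

end VKnot

/-!
The exponents occurring in the writhe polynomial of a diagram `D` are among `0` and the indices of
the classical crossings of `D`. So it suffices that each index has absolute value at most the number
`n` of virtual crossings of `D`; the width is then at most `2 n`, and `D` may be chosen with `n` as
small as possible.

The endpoint sign of a classical visit is `-1` if the other strand crosses towards the left and `1`
if it crosses towards the right; extend this rule to all visits (`Visit.side`). Because the curve
lies on the sphere, its regions can be numbered so that crossing any edge from right to left raises
the number by one (`exists_regionNumbering`). The number to the left of a point that moves along the
curve changes by `Visit.side` at each visit, and comparing the regions around a crossing shows that
the sum of `Visit.side` over the arc from a visit to its partner vanishes (`sum_side_arc`). Hence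
the index is minus the contribution of the virtual visits on the arc; at most `n` of these count
`-1` and at most `n` count `1`, so that the index lies between `-n` and `n` (`abs_index_le`).

The numbering of the regions is where planarity enters. Over `ℚ` there are maps from functions on
regions to functions on edges (`regionCoboundary`: value on the left minus value on the right) and
on to functions on crossings (`flux`: what arrives minus what leaves), with composite zero. As the
curve is connected, the kernel of the first is at most one-dimensional, and so is the cokernel of
the second, so that Euler's formula forces exactness in the middle. The function `1` on edges has
no flux, since the curve is closed; so it comes from a function on regions.
-/

namespace VKnot

/-! ### Sums over the two visits of each crossing -/

theorem exists_partner_get {w : List Visit} (hw : IsCode w) :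
    ∃ σ : Fin w.length → Fin w.length, ∀ i, w.get (σ i) = (w.get i).partner := by
  have h : ∀ i : Fin w.length, ∃ j : Fin w.length, w.get j = (w.get i).partner := fun i =>
    List.mem_iff_get.1 (hw.2.1 _ (List.get_mem w i))
  choose σ hσ using h
  exact ⟨σ, hσ⟩

/-- The positions of the visits at which the other strand crosses towards the left. There is one of
them for each crossing, and they stand for the crossings. -/
abbrev LeftPos (w : List Visit) : Type := {i : Fin w.length // (w.get i).left = true}

section Partner

variable {w : List Visit} {σ : Fin w.length → Fin w.length}

theorem partner_get_involutive (hw : IsCode w) (hσ : ∀ i, w.get (σ i) = (w.get i).partner)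
    (i : Fin w.length) : σ (σ i) = i := by
  apply (List.nodup_iff_injective_get.1 hw.1)
  rw [hσ, hσ, Visit.partner_partner]

theorem left_get_partner (hσ : ∀ i, w.get (σ i) = (w.get i).partner) (i : Fin w.length) :
    (w.get (σ i)).left = !(w.get i).left := by
  rw [hσ]; rfl

theorem sum_positions_eq {M : Type*} [AddCommMonoid M] (hw : IsCode w)
    (hσ : ∀ i, w.get (σ i) = (w.get i).partner) (f : Fin w.length → M) :
    ∑ i, f i = ∑ l : LeftPos w, (f l + f (σ l)) := by
  rw [← Fintype.sum_subtype_add_sum_subtype (fun i => (w.get i).left = true) f,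
    Finset.sum_add_distrib]
  congr 1
  refine Fintype.sum_equiv
    { toFun := fun i => ⟨σ i, by rw [left_get_partner hσ]; simpa using i.2⟩
      invFun := fun l => ⟨σ l, by rw [left_get_partner hσ, l.2]; decide⟩
      left_inv := fun i => Subtype.ext (partner_get_involutive hw hσ _)
      right_inv := fun l => Subtype.ext (partner_get_involutive hw hσ _) } _ _ fun i => ?_
  simp [partner_get_involutive hw hσ]

theorem length_eq_two_mul_card (hw : IsCode w) : w.length = 2 * Fintype.card (LeftPos w) := by
  obtain ⟨σ, hσ⟩ := exists_partner_get hw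
  have h := sum_positions_eq hw hσ fun _ => 1
  simpa [mul_comm] using h

/-- The crossing at a position. -/
def crossingAt (hσ : ∀ i, w.get (σ i) = (w.get i).partner) (i : Fin w.length) : LeftPos w :=
  if h : (w.get i).left = true then ⟨i, h⟩
  else ⟨σ i, by rw [left_get_partner hσ]; simpa using h⟩

theorem crossingAt_left (hσ : ∀ i, w.get (σ i) = (w.get i).partner) (l : LeftPos w) :
    crossingAt hσ l = l :=
  dif_pos l.2

theorem crossingAt_partner (hw : IsCode w) (hσ : ∀ i, w.get (σ i) = (w.get i).partner)
    (l : LeftPos w) : crossingAt hσ (σ l) = l := by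
  have h : (w.get (σ l)).left ≠ true := by rw [left_get_partner hσ, l.2]; decide
  rw [crossingAt, dif_neg h]
  exact Subtype.ext (partner_get_involutive hw hσ _)

end Partner

/-! ### Exactness on the sphere -/

instance (w : List Visit) : Finite (Region w) := Quot.finite _

/-- The region on a given side of an edge. -/
def region {w : List Visit} (e : Fin w.length) (b : Bool) : Region w := Quot.mk _ (e, b)

/-- A function on the regions gives a function on the edges: the value on the left minus the value
on the right. -/
def regionCoboundary (w : List Visit) : (Region w → ℚ) →ₗ[ℚ] (Fin w.length → ℚ) where
  toFun a e := a (region e true) - a (region e false)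
  map_add' a b := by ext e; simp only [Pi.add_apply]; ring
  map_smul' c a := by
    ext e; simp only [Pi.smul_apply, smul_eq_mul, RingHom.id_apply]; ring

/-- A function on the edges gives a function on the crossings: the sum over the arriving edges minus
the sum over the leaving edges. -/
def flux {w : List Visit} {σ : Fin w.length → Fin w.length}
    (hσ : ∀ i, w.get (σ i) = (w.get i).partner) : (Fin w.length → ℚ) →ₗ[ℚ] (LeftPos w → ℚ) :=
  Fintype.linearCombination ℚ fun e =>
    Pi.single (crossingAt hσ (finRotate _ e)) 1 - Pi.single (crossingAt hσ e) 1

theorem flux_apply {w : List Visit} {σ : Fin w.length → Fin w.length}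
    (hσ : ∀ i, w.get (σ i) = (w.get i).partner) (x : Fin w.length → ℚ) :
    flux hσ x = ∑ e, (x ((finRotate _).symm e) - x e) • Pi.single (crossingAt hσ e) (1 : ℚ) := by
  simp only [flux, Fintype.linearCombination_apply, smul_sub, sub_smul, Finset.sum_sub_distrib]
  congr 1
  exact Fintype.sum_equiv (finRotate _) _ _ fun e => by rw [Equiv.symm_apply_apply]

/-- A property that passes from each edge to the next one holds for all edges if it holds for
one. -/
theorem forall_of_finRotate {n : ℕ} {p : Fin n → Prop} (e₀ : Fin n) (h₀ : p e₀)
    (h : ∀ e, p e → p (finRotate n e)) (e : Fin n) : p e := by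
  have hz : ∀ k : ℕ, p (((finRotate n) ^ k) e₀) := by
    intro k
    induction k with
    | zero => exact h₀
    | succ k ih => rw [pow_succ']; exact h _ ih
  rcases n with _ | _ | n
  · exact e₀.elim0
  · rwa [show e = e₀ from Fin.ext (by omega)]
  · obtain ⟨k, hk⟩ := (isCycle_finRotate (n := n)).exists_pow_eq
      (x := e₀) (y := e) (by simp) (by simp)
    exact hk ▸ hz k

section Exact

variable {w : List Visit} {σ : Fin w.length → Fin w.length}

/-- Regions around a crossing, in terms of the edges `finRotate⁻¹ l`, `finRotate⁻¹ (σ l)` that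
arrive and the edges `l`, `σ l` that leave: the front left, front right, back left and back right
corners. -/
theorem regions_around (hσ : ∀ i, w.get (σ i) = (w.get i).partner) (l : LeftPos w) :
    region l.1 true = region (σ l) false ∧
      region l.1 false = region ((finRotate _).symm (σ l)) false ∧
      region ((finRotate _).symm l.1) true = region (σ l) true ∧
      region ((finRotate _).symm l.1) false = region ((finRotate _).symm (σ l)) true := by
  obtain ⟨i, hi⟩ := (finRotate _).surjective l.1
  obtain ⟨j, hj⟩ := (finRotate _).surjective (σ l)
  have hl : (w.get (finRotate _ i)).left = true := by rw [hi]; exact l.2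
  have hp : w.get (finRotate _ j) = (w.get (finRotate _ i)).partner := by rw [hi, hj, hσ]
  rw [← hi] at hj ⊢
  rw [← hj, Equiv.symm_apply_apply, Equiv.symm_apply_apply]
  exact ⟨Quot.sound (.front_left i j hl hp), Quot.sound (.front_right i j hl hp),
    Quot.sound (.back_left i j hl hp), Quot.sound (.back_right i j hl hp)⟩

theorem flux_regionCoboundary (hw : IsCode w) (hσ : ∀ i, w.get (σ i) = (w.get i).partner)
    (a : Region w → ℚ) : flux hσ (regionCoboundary w a) = 0 := by
  rw [flux_apply, sum_positions_eq hw hσ]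
  refine Finset.sum_eq_zero fun l _ => ?_
  rw [crossingAt_left, crossingAt_partner hw, ← add_smul]
  obtain ⟨h1, h2, h3, h4⟩ := regions_around hσ l
  simp only [regionCoboundary, LinearMap.coe_mk, AddHom.coe_mk, h1, h2, h3, h4]
  convert zero_smul ℚ _
  ring

theorem flux_one (hσ : ∀ i, w.get (σ i) = (w.get i).partner) : flux hσ 1 = 0 := by
  simp [flux_apply]

/-- A function on the regions that does not change across any edge is constant. -/
theorem finrank_ker_regionCoboundary_le (hw : IsCode w) (hne : w ≠ []) :
    Module.finrank ℚ (LinearMap.ker (regionCoboundary w)) ≤ 1 := by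
  obtain ⟨σ, hσ⟩ := exists_partner_get hw
  let e₀ : Fin w.length := ⟨0, List.length_pos_of_ne_nil hne⟩
  refine finrank_le_one (⟨1, by ext e; simp [regionCoboundary]⟩ : LinearMap.ker _) ?_
  rintro ⟨a, ha⟩
  have hs : ∀ e, a (region e true) = a (region e false) := fun e =>
    sub_eq_zero.1 (congrFun (LinearMap.mem_ker.1 ha) e)
  have hstep : ∀ e, a (region (finRotate _ e) true) = a (region e true) := by
    intro e
    by_cases hl : (w.get (finRotate _ e)).left = true
    · obtain ⟨h1, h2, h3, h4⟩ := regions_around hσ ⟨finRotate _ e, hl⟩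
      simp only [Equiv.symm_apply_apply] at h1 h2 h3 h4
      rw [h1, ← hs, ← h3]
    · have hl' : (w.get (σ (finRotate _ e))).left = true := by
        rw [left_get_partner hσ]; simpa using hl
      obtain ⟨h1, h2, h3, h4⟩ := regions_around hσ ⟨σ (finRotate _ e), hl'⟩
      simp only [partner_get_involutive hw hσ, Equiv.symm_apply_apply] at h1 h2 h3 h4
      rw [hs, hs e, ← h1, ← h2, hs]
  have hc : ∀ e, a (region e true) = a (region e₀ true) :=
    forall_of_finRotate e₀ rfl fun e he => (hstep e).trans he
  refine ⟨a (region e₀ true), Subtype.ext (funext fun r => ?_)⟩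
  obtain ⟨⟨e, b⟩, rfl⟩ := Quot.exists_rep r
  have : a (region e b) = a (region e₀ true) := by
    cases b
    · rw [← hs, hc]
    · exact hc e
  change a (region e₀ true) • (1 : ℚ) = a (region e b)
  rw [smul_eq_mul, mul_one, this]

/-- Modulo the range of `flux`, consecutive crossings of the curve become equal. -/
theorem card_le_finrank_range_flux (hσ : ∀ i, w.get (σ i) = (w.get i).partner) (hne : w ≠ []) :
    Fintype.card (LeftPos w) ≤ Module.finrank ℚ (LinearMap.range (flux hσ)) + 1 := by
  let e₀ : Fin w.length := ⟨0, List.length_pos_of_ne_nil hne⟩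
  let s : Fin w.length → LeftPos w → ℚ := fun e => Pi.single (crossingAt hσ e) 1
  have hstep : ∀ e, s e ∈ LinearMap.range (flux hσ) ⊔ Submodule.span ℚ {s e₀} :=
    forall_of_finRotate e₀ (Submodule.mem_sup_right (Submodule.mem_span_singleton_self _))
      fun e he => by
        have h : s (finRotate _ e) - s e ∈ LinearMap.range (flux hσ) :=
          ⟨Pi.single e 1, by simp [flux, s, Fintype.linearCombination_apply_single]⟩
        simpa using Submodule.add_mem _ (Submodule.mem_sup_left h) he
  have htop : LinearMap.range (flux hσ) ⊔ Submodule.span ℚ {s e₀} = ⊤ := by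
    rw [eq_top_iff, ← (Pi.basisFun ℚ (LeftPos w)).span_eq, Submodule.span_le]
    rintro _ ⟨l, rfl⟩
    have := hstep l
    simp only [s, crossingAt_left] at this
    simpa using this
  have h := Submodule.finrank_add_le_finrank_add_finrank (LinearMap.range (flux hσ))
    (Submodule.span ℚ {s e₀})
  rw [htop, finrank_top, Module.finrank_fintype_fun_eq_card] at h
  exact h.trans (Nat.add_le_add_left ((finrank_span_le_card _).trans (by simp)) _)

/-- The regions of a planar diagram can be numbered so that crossing any edge from right to left
raises the number by one. -/
theorem exists_regionNumbering (hw : IsCode w) (hpl : IsPlanar w) (hne : w ≠ []) :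
    ∃ a : Region w → ℚ, ∀ e, a (region e true) = a (region e false) + 1 := by
  obtain ⟨σ, hσ⟩ := exists_partner_get hw
  have hle : LinearMap.range (regionCoboundary w) ≤ LinearMap.ker (flux hσ) := by
    rintro _ ⟨a, rfl⟩
    exact flux_regionCoboundary hw hσ a
  have heuler := hpl.resolve_left hne
  have hlen := length_eq_two_mul_card hw
  have hF := LinearMap.finrank_range_add_finrank_ker (regionCoboundary w)
  have hE := LinearMap.finrank_range_add_finrank_ker (flux hσ)
  have := Fintype.ofFinite (Region w)
  rw [Module.finrank_fintype_fun_eq_card, ← Nat.card_eq_fintype_card] at hF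
  rw [Module.finrank_fintype_fun_eq_card, Fintype.card_fin] at hE
  have hk := finrank_ker_regionCoboundary_le hw hne
  have hr := card_le_finrank_range_flux hσ hne
  -- With `V` crossings, `E = 2 V` edges and `F` regions, the range has dimension at least `F - 1` and
  -- the kernel at most `E - (V - 1)`; these agree by Euler's formula.
  have heq := Submodule.eq_of_le_of_finrank_le hle (by omega)
  have hone : (1 : Fin w.length → ℚ) ∈ LinearMap.range (regionCoboundary w) := by
    rw [heq]; exact flux_one hσ
  obtain ⟨a, ha⟩ := hone
  refine ⟨a, fun e => ?_⟩
  have := congrFun ha e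
  simp only [regionCoboundary, LinearMap.coe_mk, AddHom.coe_mk, Pi.one_apply] at this
  linarith

end Exact

/-! ### Bounding the index -/

/-- The sign of the crossing of the other strand: `-1` towards the left, `1` towards the right. For
a classical visit this is its sign as an endpoint of a chord. -/
def Visit.side (v : Visit) : ℤ := if v.left then -1 else 1

theorem Visit.side_partner (v : Visit) : v.partner.side = -v.side := by
  rcases v with ⟨c, k, l⟩
  cases l <;> rfl

/-- The numbers to the left of the edges: they change by `Visit.side` at each visit, and the
edge leaving a visit has the same number as the edge arriving at its partner. -/
theorem exists_edgeNumbering {w : List Visit} (hw : IsCode w) (hpl : IsPlanar w) (hne : w ≠ []) :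
    ∃ h : Fin w.length → ℚ,
      (∀ e, h (finRotate _ e) = h e + (w.get (finRotate _ e)).side) ∧
      ∀ i j, w.get (finRotate _ j) = (w.get i).partner → h j = h i := by
  obtain ⟨a, ha⟩ := exists_regionNumbering hw hpl hne
  obtain ⟨σ, hσ⟩ := exists_partner_get hw
  have key : ∀ l : LeftPos w,
      a (region l.1 true) = a (region ((finRotate _).symm l.1) true) - 1 ∧
      a (region (σ l) true) = a (region ((finRotate _).symm (σ l)) true) + 1 ∧
      a (region ((finRotate _).symm (σ l)) true) = a (region l.1 true) ∧
      a (region ((finRotate _).symm l.1) true) = a (region (σ l) true) := by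
    intro l
    obtain ⟨h1, h2, h3, h4⟩ := regions_around hσ l
    have e1 := ha l.1
    have e2 := ha (σ l)
    have e3 := ha ((finRotate _).symm l.1)
    have e4 := ha ((finRotate _).symm (σ l))
    rw [h2] at e1
    rw [← h1] at e2
    rw [h4] at e3
    rw [h3] at e3 ⊢
    refine ⟨?_, ?_, ?_, rfl⟩ <;> linarith
  refine ⟨fun e => a (region e true), fun e => ?_, fun i j hij => ?_⟩
  · by_cases hl : (w.get (finRotate _ e)).left = true
    · have := (key ⟨finRotate _ e, hl⟩).1
      simp only [Equiv.symm_apply_apply] at this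
      simp only [this, Visit.side, hl, if_true]
      push_cast; ring
    · have hl' : (w.get (σ (finRotate _ e))).left = true := by
        rw [left_get_partner hσ]; simpa using hl
      have := (key ⟨σ (finRotate _ e), hl'⟩).2.1
      simp only [partner_get_involutive hw hσ, Equiv.symm_apply_apply] at this
      simp only [this, Visit.side, hl, Bool.false_eq_true, if_false]
      push_cast; ring
  · have hj : finRotate _ j = σ i :=
      List.nodup_iff_injective_get.1 hw.1 (by rw [hij, hσ])
    have hj' : j = (finRotate _).symm (σ i) := by rw [← hj, Equiv.symm_apply_apply]
    subst hj'
    by_cases hl : (w.get i).left = true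
    · exact (key ⟨i, hl⟩).2.2.1
    · have hl' : (w.get (σ i)).left = true := by
        rw [left_get_partner hσ]; simpa using hl
      have := (key ⟨σ i, hl'⟩).2.2.2
      simpa only [partner_get_involutive hw hσ] using this

/-- The word, started at a visit `v`, consists of `v`, the arc from `v` to its partner, the partner,
and a rest. -/
theorem exists_rotate_eq {w : List Visit} (hw : IsCode w) {v : Visit} (hv : v ∈ w) :
    ∃ B, w.rotate (w.idxOf v) = v :: (arc w v ++ v.partner :: B) := by
  obtain ⟨P, S, rfl⟩ := List.append_of_mem hv
  have hvP : v ∉ P := fun h => (List.nodup_append.1 hw.1).2.2 v h v (by simp) rfl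
  have hrot : (P ++ v :: S).rotate ((P ++ v :: S).idxOf v) = v :: (S ++ P) := by
    rw [List.idxOf_append_of_notMem hvP, List.idxOf_cons_self, add_zero,
      List.rotate_append_length_eq]
    simp
  have hmem : v.partner ∈ S ++ P := by
    have := hw.2.1 v hv
    simp only [List.mem_append, List.mem_cons, v.partner_ne, false_or] at this ⊢
    exact this.symm
  have hnd : (v :: (S ++ P)).Nodup := by rw [← hrot, List.nodup_rotate]; exact hw.1
  obtain ⟨A, B, hAB⟩ := List.append_of_mem hmem
  have hA : v.partner ∉ A := by
    have h := (List.nodup_cons.1 hnd).2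
    rw [hAB] at h
    exact fun h' => (List.nodup_append.1 h).2.2 _ h' _ (by simp) rfl
  refine ⟨B, ?_⟩
  rw [arc, hrot, List.tail_cons, hAB, takeWhile_ne_append _ _ _ hA]

/-- On the sphere, the two loops into which a crossing divides the curve have intersection number
zero; crossings of a loop with itself cancel. -/
theorem sum_side_arc {w : List Visit} (hw : IsCode w) (hpl : IsPlanar w) {v : Visit}
    (hv : v ∈ w) : ((arc w v).map Visit.side).sum = 0 := by
  obtain ⟨h, hstep, hcross⟩ := exists_edgeNumbering hw hpl (List.ne_nil_of_mem hv)
  obtain ⟨B, hB⟩ := exists_rotate_eq hw hv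
  have hn : 0 < w.length := List.length_pos_of_mem hv
  -- `pos k` is the position of the `k`-th visit after `v`.
  let pos : ℕ → Fin w.length := fun k => ⟨(w.idxOf v + k) % w.length, Nat.mod_lt _ hn⟩
  have hpos : ∀ k, finRotate _ (pos k) = pos (k + 1) := by
    intro k
    have : NeZero w.length := ⟨hn.ne'⟩
    apply Fin.ext
    simp [pos, finRotate_apply, Fin.val_add, ← add_assoc]
  have hget : ∀ k u, (v :: (arc w v ++ v.partner :: B))[k]? = some u → w.get (pos k) = u := by
    intro k u hk
    rw [← hB] at hk
    obtain ⟨hk', rfl⟩ := List.getElem?_eq_some_iff.1 hk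
    rw [List.getElem_rotate]
    simp [pos, add_comm]
  have hsum : ∀ A C : List Visit, arc w v = A ++ C →
      h (pos A.length) = h (pos 0) + ((A.map Visit.side).sum : ℤ) := by
    intro A
    induction A using List.reverseRecOn with
    | nil => simp
    | append_singleton A u ih =>
      intro C hC
      have hu : w.get (pos (A.length + 1)) = u := hget _ _ (by simp [hC])
      rw [List.length_append, List.length_singleton, ← hpos, hstep, hpos, hu,
        ih (u :: C) (by simpa using hC)]
      simp [add_assoc]
  have h0 : w.get (pos 0) = v := hget _ _ (by simp)
  have h1 : w.get (pos ((arc w v).length + 1)) = v.partner := hget _ _ (by simp)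
  have h2 := hcross (pos 0) (pos (arc w v).length) (by rw [hpos, h1, h0])
  have h3 := hsum (arc w v) [] (by simp)
  have : ((((arc w v).map Visit.side).sum : ℤ) : ℚ) = 0 := by linarith
  exact_mod_cast this

/-- Classical visits contribute equally to both sums, virtual visits only to that of `Visit.side`. -/
theorem sum_endSign_eq (A : List Visit) :
    (A.map Visit.endSign).sum = (A.map Visit.side).sum +
      A.countP (fun v => decide (v.kind = .virt ∧ v.left = true)) -
      A.countP (fun v => decide (v.kind = .virt ∧ v.left = false)) := by
  induction A with
  | nil => simp
  | cons v A ih =>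
    rw [List.map_cons, List.map_cons, List.sum_cons, List.sum_cons, ih, List.countP_cons,
      List.countP_cons]
    rcases v with ⟨c, k, l⟩
    cases k <;> cases l <;> simp [Visit.endSign, Visit.sign, Visit.side] <;> ring

theorem map_partner_perm {w : List Visit} (hw : IsCode w) : (w.map Visit.partner).Perm w := by
  have hinj : Function.Injective Visit.partner := fun a b h => by
    rw [← a.partner_partner, h, b.partner_partner]
  refine (List.perm_ext_iff_of_nodup (hw.1.map hinj) hw.1).2 fun a => ⟨fun h => ?_, fun h => ?_⟩
  · obtain ⟨b, hb, rfl⟩ := List.mem_map.1 h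
    exact hw.2.1 b hb
  · exact List.mem_map.2 ⟨a.partner, hw.2.1 a h, a.partner_partner⟩

theorem countP_virt_right {w : List Visit} (hw : IsCode w) :
    w.countP (fun v => decide (v.kind = .virt ∧ v.left = false)) = virtualCrossings w := by
  rw [virtualCrossings, ← (map_partner_perm hw).countP_eq, List.countP_map]
  congr 1
  funext v
  rcases v with ⟨c, k, l⟩
  cases k <;> cases l <;> rfl

theorem countP_arc_le {w : List Visit} (hw : IsCode w) {v : Visit} (hv : v ∈ w)
    (p : Visit → Bool) : (arc w v).countP p ≤ w.countP p := by
  obtain ⟨B, hB⟩ := exists_rotate_eq hw hv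
  rw [← (List.rotate_perm w (w.idxOf v)).countP_eq, hB]
  simp only [List.countP_cons, List.countP_append]
  omega

/-- At most `virtualCrossings w` virtual visits of each side lie on the arc, and the index is the
difference of their numbers. -/
theorem abs_index_le {w : List Visit} (hw : IsCode w) (hpl : IsPlanar w) {v : Visit}
    (hv : v ∈ w) : |index w v| ≤ virtualCrossings w := by
  have h1 := countP_arc_le hw hv fun v => decide (v.kind = .virt ∧ v.left = true)
  have h2 := countP_arc_le hw hv fun v => decide (v.kind = .virt ∧ v.left = false)
  rw [countP_virt_right hw] at h2
  rw [index, sum_endSign_eq, sum_side_arc hw hpl hv, abs_le]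
  unfold virtualCrossings at *
  omega

/-! ### The width of the writhe polynomial -/

open LaurentPolynomial

theorem coeff_writhePolyOfWord {w : List Visit} (hw : IsCode w) (hpl : IsPlanar w) {m : ℤ}
    (hm : (virtualCrossings w : ℤ) < |m|) : (writhePolyOfWord w).coeff m = 0 := by
  have hm0 : m ≠ 0 := by
    rintro rfl
    simp at hm
    omega
  have hsum : ∀ L : List Visit, (∀ v ∈ L, v ∈ w) →
      ((L.map fun v => (C v.sign * T (index w v) : ℤ[T;T⁻¹])).sum).coeff m = 0 := by
    intro L
    induction L with
    | nil => simp
    | cons v L ih =>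
      intro hL
      have hv := abs_index_le hw hpl (hL v (by simp))
      have hne : index w v ≠ m := by
        rintro rfl
        omega
      rw [List.map_cons, List.sum_cons, AddMonoidAlgebra.coeff_add, Finsupp.add_apply,
        ih fun u hu => hL u (by simp [hu]), ← LaurentPolynomial.single_eq_C_mul_T,
        AddMonoidAlgebra.coeff_single, Finsupp.single_eq_of_ne hne.symm, add_zero]
  rw [writhePolyOfWord, AddMonoidAlgebra.coeff_sub, Finsupp.sub_apply,
    hsum (overs w) fun v hv => (List.mem_filter.1 hv).1, ← LaurentPolynomial.single_eq_C,
    AddMonoidAlgebra.coeff_single, Finsupp.single_eq_of_ne hm0, sub_zero]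

theorem width_le_of_coeff {p : ℤ[T;T⁻¹]} {n : ℕ} (h : ∀ m : ℤ, (n : ℤ) < |m| → p.coeff m = 0) :
    width p ≤ 2 * (n : ℤ) := by
  have hle : ∀ m ∈ p.coeff.support, |m| ≤ n := fun m hm =>
    not_lt.1 fun hlt => Finsupp.mem_support_iff.1 hm (h m hlt)
  unfold width
  split_ifs with hne
  · have h1 := (abs_le.1 (hle _ (Finset.max'_mem _ hne))).2
    have h2 := (abs_le.1 (hle _ (Finset.min'_mem _ hne))).1
    omega
  · positivity

end VKnot

theorem mainTheorem6 (K : VKnot.VirtualKnot) :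
    VKnot.width (VKnot.writhePoly K) ≤ 2 * (VKnot.vc K : ℤ) := by
  have hne : {n | ∃ D : VKnot.Diagram, Quot.mk _ D = K ∧
      VKnot.virtualCrossings D.word = n}.Nonempty := by
    obtain ⟨D, hD⟩ := Quot.exists_rep K
    exact ⟨_, D, hD, rfl⟩
  obtain ⟨D, rfl, hD⟩ := Nat.sInf_mem hne
  refine VKnot.width_le_of_coeff fun m hm =>
    VKnot.coeff_writhePolyOfWord D.isCode D.isPlanar ?_
  rw [hD]
  exact hm
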